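/- For a permutation $\sigma=\sigma_1\cdots\sigma_n$ in the symmetric group $S_n$ let $\mathrm{maj}(\sigma)=\sum_{1\le i\le n-1,\ \sigma_i>\sigma_{i+1}} i$ be its major index, and let $\mathcal{D}^{AS}_n$ be the set of derangements (permutations without fixed points) in $S_n$ whose length, that is, the least number of factors in an expression as a product of simple transpositions $(i\ i+1)$, is even; equivalently, the set of derangements in the alternating group $A_n$. Let $[m]_q=1+q+\cdots+q^{m-1}$ for $m\ge 1$, $[m]_q!=[1]_q[2]_q\cdots[m]_q$ and $[0]_q!=1$. Then for every integer $n\ge 1$, as an identity of rational functions in the indeterminate $q$ over $\mathbb{Q}$ (the left-hand side being a polynomial), $$\sum_{\sigma\in\mathcal{D}^{AS}_n} q^{\mathrm{maj}(\sigma)}=[n]_q!\sum_{k=0}^{n}\frac{(-1)^k}{[k]_q!}\,q^{\binom{k}{2}}\left(\frac12+\frac12\left(\frac{1-q}{1+q}\right)^{\lfloor (n-k)/2\rfloor}\right).$$ -/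

import Mathlib

namespace DerangementMaj

/-- The simple transpositions `s_i = (i, i+1)`, i.e. the standard Coxeter generators of
the symmetric group on `n` letters (letters and positions are numbered from `0`). -/
def simpleTranspositions (n : ℕ) : Set (Equiv.Perm (Fin n)) :=
  {s | ∃ (i : ℕ) (h : i + 1 < n), s = Equiv.swap ⟨i, Nat.lt_of_succ_lt h⟩ ⟨i + 1, h⟩}

/-- The Coxeter length of `σ`: the least `k` such that `σ` is a product of `k` simple
transpositions. -/
noncomputable def length {n : ℕ} (σ : Equiv.Perm (Fin n)) : ℕ :=
  sInf {k | ∃ w : List (Equiv.Perm (Fin n)),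
    w.length = k ∧ (∀ s ∈ w, s ∈ simpleTranspositions n) ∧ w.prod = σ}

/-- The simple transpositions generate, so the minimum in `length` is attained. -/
theorem exists_word_of_length {n : ℕ} (σ : Equiv.Perm (Fin n)) :
    ∃ w : List (Equiv.Perm (Fin n)),
      w.length = length σ ∧ (∀ s ∈ w, s ∈ simpleTranspositions n) ∧ w.prod = σ := by
  refine Nat.sInf_mem (s := {k | ∃ w : List (Equiv.Perm (Fin n)),
    w.length = k ∧ (∀ s ∈ w, s ∈ simpleTranspositions n) ∧ w.prod = σ}) ?_
  have h : σ ∈ Submonoid.closure (simpleTranspositions n) := by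
    cases n with
    | zero =>
      rw [Subsingleton.elim σ 1]
      exact one_mem _
    | succ m =>
      have e := Equiv.Perm.mclosure_swap_castSucc_succ m
      have hσ : σ ∈ (⊤ : Submonoid (Equiv.Perm (Fin (m + 1)))) := Submonoid.mem_top σ
      rw [← e] at hσ
      refine Submonoid.closure_mono ?_ hσ
      rintro _ ⟨i, rfl⟩
      exact ⟨i, Nat.succ_lt_succ i.2, rfl⟩
  obtain ⟨w, hw, hp⟩ := Submonoid.exists_list_of_mem_closure h
  exact ⟨w.length, w, rfl, hw, hp⟩

/-- A permutation has even length exactly if it lies in the alternating group. -/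
theorem even_length_iff {n : ℕ} (σ : Equiv.Perm (Fin n)) :
    Even (length σ) ↔ σ ∈ alternatingGroup (Fin n) := by
  obtain ⟨w, hl, hs, hp⟩ := exists_word_of_length σ
  have hsw : ∀ s ∈ w, s.IsSwap := by
    intro s h
    obtain ⟨i, hi, rfl⟩ := hs s h
    exact ⟨_, _, by simp [Fin.ext_iff], rfl⟩
  rw [← hp, Equiv.Perm.prod_list_swap_mem_alternatingGroup_iff_even_length hsw, hl, hp]

/-- The descent set of `σ`: the positions whose entry is larger than the next entry. -/
def descents {n : ℕ} (σ : Equiv.Perm (Fin n)) : Finset (Fin n) :=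
  {i | ∃ h : (i : ℕ) + 1 < n, σ ⟨(i : ℕ) + 1, h⟩ < σ i}

/-- The major index of `σ`: the sum of the descents of `σ`. As positions in `Fin n` start
at `0`, the position `i : Fin n` is position `i + 1` in the usual numbering `1, …, n`. -/
def maj {n : ℕ} (σ : Equiv.Perm (Fin n)) : ℕ :=
  ∑ i ∈ descents σ, ((i : ℕ) + 1)

open Classical in
/-- The derangements of even length in the symmetric group on `n` letters. -/
noncomputable def evenDerangements (n : ℕ) : Finset (Equiv.Perm (Fin n)) :=
  {σ | σ ∈ derangements (Fin n) ∧ Even (length σ)}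

/-- The Mahonian polynomial, in the indeterminate `q = X`, of the derangements of even length. -/
noncomputable def evenDerangementPoly (n : ℕ) : Polynomial ℚ :=
  ∑ σ ∈ evenDerangements n, Polynomial.X ^ maj σ

/-- `[m]_q = 1 + q + ⋯ + q ^ (m - 1)`. -/
def qNumber {R : Type*} [CommSemiring R] (q : R) (m : ℕ) : R :=
  ∑ i ∈ Finset.range m, q ^ i

/-- `[m]_q! = [1]_q [2]_q ⋯ [m]_q`, with `[0]_q! = 1`. -/
def qFactorial {R : Type*} [CommSemiring R] (q : R) (m : ℕ) : R :=
  ∏ i ∈ Finset.Icc 1 m, qNumber q i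

end DerangementMaj

/-! The indicator of even length is `(1 + sign) / 2`, so it suffices to sum `χ (sign σ) * q ^ maj σ`
over derangements for the trivial character and for the sign.

A permutation amounts to its support `S` and a derangement `δ` of `S.card` points. Replace its
entries by labels: negative at subcedants, positive at excedants, zero at fixed points. This keeps
the descents (`IsLabelling.maj_eq`), and the label word arises from that of `δ` by inserting zeros
outside `S`. Summing over all `S` of size `k` multiplies `q ^ maj δ` by a Gaussian binomial
(`sum_pow_wordMaj_padZeros`). Fixed points do not affect the sign, so the sum over all permutations
is a Gaussian binomial transform of the sums over derangements (`permSum_eq_sum_gaussBinom`), which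
`gaussBinom_inversion` inverts.

The sums over all permutations are products: with `ε = χ (-1)`, the factor for size `n + 1` is `[n +
1]` at `ε ^ n * q`. Induction gives this once the sum is refined by the last entry
(`sum_appendLast`). -/

namespace DerangementMaj

/-! ### Gaussian binomials and their inversion. -/

section QAnalogues

variable {K : Type*} [Field K] {q : K}

theorem qNumber_add {R : Type*} [CommSemiring R] (q : R) (a b : ℕ) :
    qNumber q (a + b) = qNumber q a + q ^ a * qNumber q b := by
  simp [qNumber, Finset.sum_range_add, Finset.mul_sum, pow_add]

@[simp]
theorem qFactorial_zero {R : Type*} [CommSemiring R] (q : R) : qFactorial q 0 = 1 := by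
  simp [qFactorial]

theorem qFactorial_succ {R : Type*} [CommSemiring R] (q : R) (n : ℕ) :
    qFactorial q (n + 1) = qFactorial q n * qNumber q (n + 1) := by
  simp [qFactorial, Finset.prod_Icc_succ_top]

/-- The Gaussian binomial coefficient, as a quotient of `q`-factorials. -/
def gaussBinom (q : K) (n k : ℕ) : K :=
  if k ≤ n then qFactorial q n / (qFactorial q k * qFactorial q (n - k)) else 0

theorem gaussBinom_of_lt (q : K) {n k : ℕ} (h : n < k) : gaussBinom q n k = 0 :=
  if_neg (by omega)

theorem gaussBinom_zero_right (hq : ∀ m, qFactorial q m ≠ 0) (n : ℕ) : gaussBinom q n 0 = 1 := by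
  simp [gaussBinom, hq]

theorem gaussBinom_self (hq : ∀ m, qFactorial q m ≠ 0) (n : ℕ) : gaussBinom q n n = 1 := by
  simp [gaussBinom, hq]

theorem gaussBinom_add (q : K) (k m : ℕ) :
    gaussBinom q (k + m) k = qFactorial q (k + m) / (qFactorial q k * qFactorial q m) := by
  simp [gaussBinom]

theorem gaussBinom_succ_succ (hq : ∀ m, qFactorial q m ≠ 0) (n k : ℕ) :
    gaussBinom q (n + 1) (k + 1) = gaussBinom q n k + q ^ (k + 1) * gaussBinom q n (k + 1) := by
  rcases lt_trichotomy n k with h | rfl | h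
  · simp [gaussBinom_of_lt, h, h.trans (Nat.lt_succ_self k)]
  · simp [gaussBinom_self hq, gaussBinom_of_lt]
  · obtain ⟨m, rfl⟩ := Nat.exists_eq_add_of_lt h
    have e1 : k + m + 1 + 1 = (k + 1) + (m + 1) := by ring
    have e2 : k + m + 1 = (k + 1) + m := by ring
    have e3 : k + m + 1 = k + (m + 1) := by ring
    have h1 := gaussBinom_add q (k + 1) (m + 1)
    have h2 := gaussBinom_add q (k + 1) m
    have h3 := gaussBinom_add q k (m + 1)
    rw [← e1] at h1
    rw [← e2] at h2
    rw [← e3] at h3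
    rw [h1, h2, h3, qFactorial_succ q (k + m + 1), e1, qNumber_add]
    have a1 := qFactorial_succ q k
    have a2 := qFactorial_succ q m
    have := hq k
    have := hq m
    have := hq (k + 1)
    have := hq (m + 1)
    have n1 : qNumber q (k + 1) ≠ 0 := right_ne_zero_of_mul (a1 ▸ hq (k + 1))
    have n2 : qNumber q (m + 1) ≠ 0 := right_ne_zero_of_mul (a2 ▸ hq (m + 1))
    rw [a1, a2]
    field_simp

theorem gaussBinom_succ_succ' (hq : ∀ m, qFactorial q m ≠ 0) {n k : ℕ} (h : k ≤ n) :
    gaussBinom q (n + 1) (k + 1) = q ^ (n - k) * gaussBinom q n k + gaussBinom q n (k + 1) := by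
  rcases h.eq_or_lt with rfl | h
  · simp [gaussBinom_self hq, gaussBinom_of_lt]
  · obtain ⟨m, rfl⟩ := Nat.exists_eq_add_of_lt h
    have e1 : k + m + 1 + 1 = (k + 1) + (m + 1) := by ring
    have e2 : k + m + 1 = (k + 1) + m := by ring
    have e3 : k + m + 1 = k + (m + 1) := by ring
    have h1 := gaussBinom_add q (k + 1) (m + 1)
    have h2 := gaussBinom_add q (k + 1) m
    have h3 := gaussBinom_add q k (m + 1)
    rw [← e1] at h1
    rw [← e2] at h2
    rw [← e3] at h3
    rw [h1, h2, h3, qFactorial_succ q (k + m + 1), e1, add_comm (k + 1) (m + 1), qNumber_add,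
      show k + m + 1 - k = m + 1 by omega]
    have a1 := qFactorial_succ q k
    have a2 := qFactorial_succ q m
    have := hq k
    have := hq m
    have n1 : qNumber q (k + 1) ≠ 0 := right_ne_zero_of_mul (a1 ▸ hq (k + 1))
    have n2 : qNumber q (m + 1) ≠ 0 := right_ne_zero_of_mul (a2 ▸ hq (m + 1))
    rw [a1, a2]
    field_simp
    ring

/-- By the first `q`-Pascal rule, the alternating sum telescopes. -/
theorem sum_range_neg_one_pow_mul_gaussBinom (hq : ∀ m, qFactorial q m ≠ 0) (n j : ℕ) :
    ∑ i ∈ Finset.range (j + 1), (-1) ^ i * q ^ i.choose 2 * gaussBinom q (n + 1) i =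
      (-1) ^ j * q ^ (j + 1).choose 2 * gaussBinom q n j := by
  induction j with
  | zero => simp [gaussBinom_zero_right hq]
  | succ j ih =>
    have e : (j + 1 + 1).choose 2 = (j + 1) + (j + 1).choose 2 := by
      rw [Nat.choose_succ_succ' (j + 1) 1, Nat.choose_one_right]
    rw [Finset.sum_range_succ, ih, gaussBinom_succ_succ hq, e]
    ring

/-- The two `q`-exponential series are inverse to each other. -/
theorem qExp_mul_qExp (hq : ∀ m, qFactorial q m ≠ 0) :
    (PowerSeries.mk fun i => (-1) ^ i * q ^ i.choose 2 / qFactorial q i) *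
      (PowerSeries.mk fun i => 1 / qFactorial q i) = 1 := by
  ext n
  rw [PowerSeries.coeff_mul, PowerSeries.coeff_one,
    Finset.Nat.sum_antidiagonal_eq_sum_range_succ_mk]
  simp only [PowerSeries.coeff_mk]
  have key : ∀ i ∈ Finset.range (n + 1),
      (-1) ^ i * q ^ i.choose 2 / qFactorial q i * (1 / qFactorial q (n - i)) =
        (1 / qFactorial q n) * ((-1) ^ i * q ^ i.choose 2 * gaussBinom q n i) := by
    intro i hi
    have hi : i ≤ n := by simpa [Nat.lt_succ_iff] using hi
    rw [gaussBinom, if_pos hi]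
    have := hq i
    have := hq n
    have := hq (n - i)
    field_simp
  rw [Finset.sum_congr rfl key, ← Finset.mul_sum]
  cases n with
  | zero => simp [gaussBinom_self hq]
  | succ n =>
    -- The full alternating sum telescopes to a multiple of the binomial `n` over `n + 1`, which is
    -- zero.
    rw [sum_range_neg_one_pow_mul_gaussBinom hq, gaussBinom_of_lt q (Nat.lt_succ_self n)]
    simp

/-- Gaussian inversion. -/
theorem gaussBinom_inversion (hq : ∀ m, qFactorial q m ≠ 0) {T D : ℕ → K}
    (h : ∀ n, T n = ∑ k ∈ Finset.range (n + 1), gaussBinom q n k * D k) (n : ℕ) :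
    D n = qFactorial q n * ∑ k ∈ Finset.range (n + 1),
      (-1) ^ k / qFactorial q k * q ^ k.choose 2 * (T (n - k) / qFactorial q (n - k)) := by
  -- Divided by `q`-factorials, the hypothesis is a Cauchy product with the `q`-exponential.
  have hT : (PowerSeries.mk fun i => 1 / qFactorial q i) *
      (PowerSeries.mk fun i => D i / qFactorial q i) =
        PowerSeries.mk fun i => T i / qFactorial q i := by
    ext n
    rw [mul_comm, PowerSeries.coeff_mul, Finset.Nat.sum_antidiagonal_eq_sum_range_succ_mk]
    simp only [PowerSeries.coeff_mk]
    rw [h n, Finset.sum_div]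
    refine Finset.sum_congr rfl fun i hi => ?_
    have hi : i ≤ n := by simpa [Nat.lt_succ_iff] using hi
    rw [gaussBinom, if_pos hi]
    have := hq i
    have := hq n
    have := hq (n - i)
    field_simp
  have hD := congrArg (fun f => PowerSeries.coeff n
    ((PowerSeries.mk fun i => (-1) ^ i * q ^ i.choose 2 / qFactorial q i) * f)) hT
  simp only [← mul_assoc, qExp_mul_qExp hq, one_mul, PowerSeries.coeff_mk] at hD
  rw [PowerSeries.coeff_mul, Finset.Nat.sum_antidiagonal_eq_sum_range_succ_mk] at hD
  simp only [PowerSeries.coeff_mk] at hD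
  rw [div_eq_iff (hq n), mul_comm] at hD
  rw [hD]
  congr 1
  exact Finset.sum_congr rfl fun k _ => by ring

end QAnalogues

/-! ### Inserting zeros into a word of nonzero letters. -/

/-- The major index of the word `f 0, f 1, …, f n`. -/
def wordMaj (f : ℕ → ℤ) (n : ℕ) : ℕ :=
  ∑ i ∈ Finset.range n, if f (i + 1) < f i then i + 1 else 0

theorem wordMaj_succ (f : ℕ → ℤ) (n : ℕ) :
    wordMaj f (n + 1) = wordMaj f n + if f (n + 1) < f n then n + 1 else 0 := by
  simp [wordMaj, Finset.sum_range_succ]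

theorem wordMaj_congr {f g : ℕ → ℤ} {n : ℕ} (h : ∀ i ≤ n, f i = g i) :
    wordMaj f n = wordMaj g n := by
  refine Finset.sum_congr rfl fun i hi => ?_
  have hi := Finset.mem_range.1 hi
  rw [h i (by omega), h (i + 1) (by omega)]

/-- The word that has the letters of `w`, in order, at the positions in `S`, and `0` elsewhere. -/
def padZeros (S : Finset ℕ) (w : ℕ → ℤ) (i : ℕ) : ℤ :=
  if i ∈ S then w (S.filter (· < i)).card else 0

theorem padZeros_insert {S : Finset ℕ} {n : ℕ} (w : ℕ → ℤ) {i : ℕ} (hi : i < n) :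
    padZeros (insert n S) w i = padZeros S w i := by
  have : ¬ n < i := by omega
  simp [padZeros, Finset.filter_insert, hi.ne, this]

theorem padZeros_insert_self {S : Finset ℕ} {n k : ℕ} (w : ℕ → ℤ)
    (hS : S ∈ Finset.powersetCard k (Finset.range n)) : padZeros (insert n S) w n = w k := by
  obtain ⟨h, rfl⟩ := Finset.mem_powersetCard.1 hS
  have : S.filter (· < n) = S := Finset.filter_true_of_mem fun i hi => Finset.mem_range.1 (h hi)
  simp [padZeros, Finset.filter_insert, this]

theorem padZeros_of_mem_powersetCard {S : Finset ℕ} {n k i : ℕ} (w : ℕ → ℤ)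
    (hS : S ∈ Finset.powersetCard k (Finset.range n)) (hi : n ≤ i) : padZeros S w i = 0 := by
  refine if_neg fun h => ?_
  have := Finset.mem_range.1 ((Finset.mem_powersetCard.1 hS).1 h)
  omega

theorem powersetCard_succ_empty {α : Type*} (k : ℕ) :
    Finset.powersetCard (k + 1) (∅ : Finset α) = ∅ :=
  Finset.powersetCard_eq_empty.2 (by simp)

theorem sum_powersetCard_range_succ {M : Type*} [AddCommMonoid M] (n k : ℕ)
    (f : Finset ℕ → M) :
    ∑ S ∈ Finset.powersetCard (k + 1) (Finset.range (n + 1)), f S =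
      ∑ S ∈ Finset.powersetCard (k + 1) (Finset.range n), f S +
        ∑ S ∈ Finset.powersetCard k (Finset.range n), f (insert n S) := by
  have hn : n ∉ Finset.range n := by simp
  have hnS : ∀ {l : ℕ}, ∀ S ∈ Finset.powersetCard l (Finset.range n), n ∉ S :=
    fun S hS h => hn ((Finset.mem_powersetCard.1 hS).1 h)
  rw [Finset.range_add_one, Finset.powersetCard_succ_insert hn, Finset.sum_union, Finset.sum_image]
  · intro S hS T hT h
    rw [← Finset.erase_insert (hnS S hS), ← Finset.erase_insert (hnS T hT), h]
  · rw [Finset.disjoint_left]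
    intro S hS hS'
    obtain ⟨T, -, rfl⟩ := Finset.mem_image.1 hS'
    exact hnS _ hS (Finset.mem_insert_self n T)

section Shuffle

variable {K : Type*} [Field K] {q : K}

/-- The sum over the words of length `n + 1` that end in `0` and arise from the first `k`
letters of `w` by inserting zeros. -/
def sumEndZero (q : K) (w : ℕ → ℤ) (n k : ℕ) : K :=
  ∑ S ∈ Finset.powersetCard k (Finset.range n), q ^ wordMaj (padZeros S w) n

/-- The sum over the words of length `n + 1` that end in `w k` and arise from the first `k + 1`
letters of `w` by inserting zeros. -/
def sumEndLetter (q : K) (w : ℕ → ℤ) (n k : ℕ) : K :=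
  ∑ S ∈ Finset.powersetCard k (Finset.range n), q ^ wordMaj (padZeros (insert n S) w) n

/-- Split by whether position `n`, just before the final zero, holds a zero or the letter `w k`;
only a positive letter makes a descent there. -/
theorem sumEndZero_succ_succ (q : K) (w : ℕ → ℤ) (n k : ℕ) :
    sumEndZero q w (n + 1) (k + 1) = sumEndZero q w n (k + 1) +
      sumEndLetter q w n k * (if 0 < w k then q ^ (n + 1) else 1) := by
  rw [sumEndZero, sum_powersetCard_range_succ, sumEndZero, sumEndLetter, Finset.sum_mul]
  congr 1 <;> refine Finset.sum_congr rfl fun S hS => ?_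
  · rw [wordMaj_succ, padZeros_of_mem_powersetCard w hS le_rfl,
      padZeros_of_mem_powersetCard w hS (Nat.le_succ n)]
    simp
  · have h : padZeros (insert n S) w (n + 1) = 0 := by
      refine if_neg fun h => ?_
      rcases Finset.mem_insert.1 h with h | h
      · omega
      · have := Finset.mem_range.1 ((Finset.mem_powersetCard.1 hS).1 h)
        omega
    rw [wordMaj_succ, padZeros_insert_self w hS, h, pow_add]
    split_ifs <;> simp

theorem sumEndLetter_succ_zero (q : K) (w : ℕ → ℤ) (n : ℕ) :
    sumEndLetter q w (n + 1) 0 = if w 0 < 0 then q ^ (n + 1) else 1 := by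
  have h0 : ∀ i, i < n + 1 → padZeros {n + 1} w i = 0 := fun i hi =>
    if_neg (by simp only [Finset.mem_singleton]; omega)
  have h1 : padZeros {n + 1} w (n + 1) = w 0 := by
    simp [padZeros, Finset.filter_singleton, -Order.lt_add_one_iff]
  have h2 : wordMaj (padZeros {n + 1} w) n = 0 := by
    refine Finset.sum_eq_zero fun i hi => ?_
    have := Finset.mem_range.1 hi
    rw [h0 i (by omega), h0 (i + 1) (by omega)]
    simp
  simp only [sumEndLetter, Finset.powersetCard_zero, Finset.sum_singleton, insert_empty_eq,
    wordMaj_succ, h2, h1, h0 n (Nat.lt_succ_self n)]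
  split_ifs <;> simp

theorem sumEndLetter_succ_succ (q : K) (w : ℕ → ℤ) (n k : ℕ) :
    sumEndLetter q w (n + 1) (k + 1) =
      sumEndZero q w n (k + 1) * (if w (k + 1) < 0 then q ^ (n + 1) else 1) +
      sumEndLetter q w n k * (if w (k + 1) < w k then q ^ (n + 1) else 1) := by
  have hc : ∀ S : Finset ℕ, wordMaj (padZeros (insert (n + 1) S) w) n = wordMaj (padZeros S w) n :=
    fun S => wordMaj_congr fun i hi => padZeros_insert w (Nat.lt_succ_of_le hi)
  have hs : ∀ {l : ℕ}, ∀ S ∈ Finset.powersetCard l (Finset.range n),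
      S ∈ Finset.powersetCard l (Finset.range (n + 1)) := fun S hS =>
    Finset.powersetCard_mono (Finset.range_subset_range.2 (Nat.le_succ n)) hS
  rw [sumEndLetter, sum_powersetCard_range_succ, sumEndZero, sumEndLetter, Finset.sum_mul,
    Finset.sum_mul]
  congr 1 <;> refine Finset.sum_congr rfl fun S hS => ?_
  · rw [wordMaj_succ, hc, padZeros_insert_self w (hs S hS), padZeros_insert w (Nat.lt_succ_self n),
      padZeros_of_mem_powersetCard w hS le_rfl, pow_add]
    split_ifs <;> simp
  · have hS' : insert n S ∈ Finset.powersetCard (k + 1) (Finset.range (n + 1)) := by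
      obtain ⟨h1, rfl⟩ := Finset.mem_powersetCard.1 hS
      refine Finset.mem_powersetCard.2 ⟨?_, Finset.card_insert_of_notMem fun h => ?_⟩
      · rw [Finset.range_add_one]
        exact Finset.insert_subset_insert _ h1
      · simpa using h1 h
    rw [wordMaj_succ, hc, padZeros_insert_self w hS', padZeros_insert w (Nat.lt_succ_self n),
      padZeros_insert_self w hS, pow_add]
    split_ifs <;> simp

/-- The last comparison depends on both final entries, so words ending in zero and words ending in a
letter are treated in one induction. In each sign pattern the recurrence becomes one of the two
`q`-Pascal rules. -/
theorem sumEnd_eq (hq : ∀ m, qFactorial q m ≠ 0) {w : ℕ → ℤ} (n : ℕ) :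
    (∀ k, (∀ i ≤ k, w i ≠ 0) → sumEndZero q w n (k + 1) =
      q ^ wordMaj w k * (if 0 < w k then q ^ (k + 1) else 1) * gaussBinom q n (k + 1)) ∧
    (∀ k, (∀ i ≤ k, w i ≠ 0) → sumEndLetter q w n k =
      q ^ wordMaj w k * (if w k < 0 then q ^ (n - k) else 1) * gaussBinom q n k) := by
  induction n with
  | zero =>
    refine ⟨fun k _ => ?_, fun k _ => ?_⟩
    · simp [sumEndZero, gaussBinom_of_lt, powersetCard_succ_empty]
    · cases k with
      | zero => simp [sumEndLetter, gaussBinom_self hq, wordMaj]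
      | succ k => simp [sumEndLetter, gaussBinom_of_lt, powersetCard_succ_empty]
  | succ n ih =>
    obtain ⟨ihZ, ihL⟩ := ih
    refine ⟨fun k hk => ?_, fun k hk => ?_⟩
    · rw [sumEndZero_succ_succ, ihZ k hk, ihL k hk]
      rcases lt_or_gt_of_ne (hk k le_rfl) with h | h
      · have h' : ¬ 0 < w k := by omega
        simp only [h, h', if_true, if_false]
        by_cases hn : k ≤ n
        · rw [gaussBinom_succ_succ' hq hn]
          ring
        · rw [gaussBinom_of_lt q (show n < k by omega),
            gaussBinom_of_lt q (show n < k + 1 by omega),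
            gaussBinom_of_lt q (show n + 1 < k + 1 by omega)]
          ring
      · have h' : ¬ w k < 0 := by omega
        simp only [h, h', if_true, if_false]
        by_cases hn : k ≤ n
        · rw [gaussBinom_succ_succ' hq hn]
          have : q ^ (n + 1) = q ^ (k + 1) * q ^ (n - k) := by
            rw [← pow_add]
            congr 1
            omega
          rw [this]
          ring
        · rw [gaussBinom_of_lt q (show n < k by omega),
            gaussBinom_of_lt q (show n < k + 1 by omega),
            gaussBinom_of_lt q (show n + 1 < k + 1 by omega)]
          ring
    · cases k with
      | zero => simp [sumEndLetter_succ_zero, gaussBinom_zero_right hq, wordMaj]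
      | succ k =>
        have hk' : ∀ i ≤ k, w i ≠ 0 := fun i hi => hk i (by omega)
        rw [sumEndLetter_succ_succ, ihZ k hk', ihL k hk', wordMaj_succ, pow_add]
        have ha := hk (k + 1) le_rfl
        have hb := hk' k le_rfl
        by_cases hn : k ≤ n
        · have e : q ^ (n + 1) = q ^ (k + 1) * q ^ (n - k) := by
            rw [← pow_add]
            congr 1
            omega
          rw [show n + 1 - (k + 1) = n - k by omega]
          -- Of the eight patterns, `omega` discards two: a step from positive to negative must
          -- descend, one from negative to positive must not.
          rcases lt_or_gt_of_ne ha with h1 | h1 <;> rcases lt_or_gt_of_ne hb with h2 | h2 <;>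
            by_cases h3 : w (k + 1) < w k <;> try omega
          · simp only [h1, h2, h2.not_gt, h3, if_true, if_false, gaussBinom_succ_succ' hq hn, e]
            ring
          · simp only [h1, h2, h2.not_gt, h3, if_true, if_false, gaussBinom_succ_succ hq, e]
            ring
          · simp only [h1, h2, h2.not_gt, h3, if_true, if_false, gaussBinom_succ_succ hq, e]
            ring
          · simp only [h1.not_gt, h2, h2.not_gt, h3, if_true, if_false,
              gaussBinom_succ_succ' hq hn, e]
            ring
          · simp only [h1.not_gt, h2, h2.not_gt, h3, if_true, if_false,
              gaussBinom_succ_succ' hq hn, e]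
            ring
          · simp only [h1.not_gt, h2, h2.not_gt, h3, if_true, if_false,
              gaussBinom_succ_succ hq, e]
            ring
        · rw [gaussBinom_of_lt q (show n < k by omega),
            gaussBinom_of_lt q (show n < k + 1 by omega),
            gaussBinom_of_lt q (show n + 1 < k + 1 by omega)]
          ring

/-- The distribution of the major index over the words obtained by inserting zeros into a word
without zeros. -/
theorem sum_pow_wordMaj_padZeros (hq : ∀ m, qFactorial q m ≠ 0) {w : ℕ → ℤ} (n k : ℕ)
    (hw : ∀ i < k, w i ≠ 0) :
    ∑ S ∈ Finset.powersetCard k (Finset.range n), q ^ wordMaj (padZeros S w) (n - 1) =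
      q ^ wordMaj w (k - 1) * gaussBinom q n k := by
  cases k with
  | zero => simp [padZeros, wordMaj, gaussBinom_zero_right hq]
  | succ k =>
    cases n with
    | zero => simp [gaussBinom_of_lt, powersetCard_succ_empty]
    | succ n =>
      have hk : ∀ i ≤ k, w i ≠ 0 := fun i hi => hw i (Nat.lt_succ_of_le hi)
      have h1 := (sumEnd_eq hq n).1 k hk
      have h2 := (sumEnd_eq hq n).2 k hk
      rw [sumEndZero] at h1
      rw [sumEndLetter] at h2
      rw [sum_powersetCard_range_succ]
      simp only [Nat.add_sub_cancel]
      rw [h1, h2]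
      -- The sign of the last letter decides which `q`-Pascal rule adds up the two kinds of words.
      rcases lt_or_gt_of_ne (hk k le_rfl) with h | h
      · by_cases hn : k ≤ n
        · simp only [h, h.not_gt, if_true, if_false, gaussBinom_succ_succ' hq hn]
          ring
        · rw [gaussBinom_of_lt q (show n < k by omega),
            gaussBinom_of_lt q (show n < k + 1 by omega),
            gaussBinom_of_lt q (show n + 1 < k + 1 by omega)]
          ring
      · simp only [h, h.not_gt, if_true, if_false, gaussBinom_succ_succ hq]
        ring

end Shuffle

/-! ### The signed and unsigned major index over all permutations. -/

section LastLetter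

theorem maj_eq_sum {n : ℕ} (σ : Equiv.Perm (Fin (n + 1))) :
    maj σ = ∑ i : Fin n, if σ i.succ < σ i.castSucc then (i : ℕ) + 1 else 0 := by
  rw [maj, descents, Finset.sum_filter, Fin.sum_univ_castSucc, if_neg, add_zero]
  · refine Finset.sum_congr rfl fun i _ => ?_
    have : (∃ h : (i.castSucc : ℕ) + 1 < n + 1,
        σ ⟨(i.castSucc : ℕ) + 1, h⟩ < σ i.castSucc) ↔ σ i.succ < σ i.castSucc :=
      ⟨fun ⟨_, h⟩ => h, fun h => ⟨by simp, h⟩⟩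
    rw [if_congr this rfl rfl, Fin.val_castSucc]
  · rintro ⟨h, -⟩
    simp at h

theorem maj_of_perm_zero (σ : Equiv.Perm (Fin 0)) : maj σ = 0 := by
  simp [maj, descents]

/-- The permutation with last entry `j` whose other entries are ordered like those of `τ`. -/
def appendLast {n : ℕ} (j : Fin (n + 1)) (τ : Equiv.Perm (Fin n)) : Equiv.Perm (Fin (n + 1)) :=
  -- The rotation takes the last position to `0` and shifts the others up; the middle factor fixes
  -- `0` and applies `τ` to the rest; the inverse cycle sends `0` to `j` and the rest past it in
  -- order.
  j.cycleRange.symm * Equiv.Perm.decomposeFin.symm (0, τ) * finRotate (n + 1)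

@[simp]
theorem appendLast_last {n : ℕ} (j : Fin (n + 1)) (τ : Equiv.Perm (Fin n)) :
    appendLast j τ (Fin.last n) = j := by
  simp [appendLast]

@[simp]
theorem appendLast_castSucc {n : ℕ} (j : Fin (n + 1)) (τ : Equiv.Perm (Fin n)) (i : Fin n) :
    appendLast j τ i.castSucc = j.succAbove (τ i) := by
  simp [appendLast]

theorem sign_appendLast {n : ℕ} (j : Fin (n + 1)) (τ : Equiv.Perm (Fin n)) :
    (appendLast j τ).sign = (-1) ^ ((j : ℕ) + n) * τ.sign := by
  rw [appendLast, map_mul, map_mul, Equiv.Perm.sign_symm, Fin.sign_cycleRange,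
    Equiv.Perm.decomposeFin.symm_sign, sign_finRotate, pow_add]
  simp [mul_right_comm]

theorem appendLast_bijective (n : ℕ) :
    Function.Bijective fun p : Fin (n + 1) × Equiv.Perm (Fin n) => appendLast p.1 p.2 := by
  rw [Fintype.bijective_iff_injective_and_card]
  refine ⟨?_, by simp [Fintype.card_perm, Nat.factorial_succ]⟩
  rintro ⟨i, σ⟩ ⟨j, τ⟩ h
  have hij : i = j := by
    have := congrArg (fun f : Equiv.Perm (Fin (n + 1)) => f (Fin.last n)) h
    simpa using this
  subst hij
  refine Prod.ext rfl (Equiv.ext fun x => ?_)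
  have := congrArg (fun f : Equiv.Perm (Fin (n + 1)) => f x.castSucc) h
  simpa using this

theorem sum_perm_succ {M : Type*} [AddCommMonoid M] {n : ℕ}
    (f : Equiv.Perm (Fin (n + 1)) → M) :
    ∑ σ, f σ = ∑ j : Fin (n + 1), ∑ τ : Equiv.Perm (Fin n), f (appendLast j τ) := by
  rw [← Fintype.sum_prod_type', ← (appendLast_bijective n).sum_comp]

/-- `j.succAbove` is increasing, so old descents persist. The new comparison involves only the two
last entries, which is why the sums below are refined by the last entry. -/
theorem maj_appendLast_appendLast {n : ℕ} (j : Fin (n + 2)) (i : Fin (n + 1))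
    (τ : Equiv.Perm (Fin n)) :
    maj (appendLast j (appendLast i τ)) =
      maj (appendLast i τ) + if (j : ℕ) ≤ i then n + 1 else 0 := by
  rw [maj_eq_sum, maj_eq_sum, Fin.sum_univ_castSucc]
  congr 1
  · refine Finset.sum_congr rfl fun x _ => ?_
    rw [Fin.succ_castSucc, appendLast_castSucc, appendLast_castSucc]
    exact if_congr (Fin.strictMono_succAbove j).lt_iff_lt rfl rfl
  · rw [Fin.succ_last, appendLast_last, appendLast_castSucc, appendLast_last]
    exact if_congr (Fin.lt_succAbove_iff_le_castSucc j i) rfl rfl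

variable {R : Type*} [CommRing R] (χ : ℤˣ →* R) (q : R)

/-- The sum of `χ (sign σ) * q ^ maj σ` over all permutations `σ` of `n` letters. -/
def permSum (n : ℕ) : R :=
  ∑ σ : Equiv.Perm (Fin n), χ σ.sign * q ^ maj σ

theorem permSum_zero : permSum χ q 0 = 1 := by
  simp [permSum, maj_of_perm_zero]

theorem sum_range_pow_sub {R : Type*} [CommSemiring R] (p : R) (m : ℕ) :
    ∑ i ∈ Finset.range m, p ^ (m - 1 - i) = qNumber p m :=
  Finset.sum_range_reflect (fun i => p ^ i) m

theorem sum_range_ite_mul_pow {R : Type*} [CommSemiring R] (p x : R) (j c : ℕ) :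
    ∑ i ∈ Finset.range (j + c), (if j ≤ i then x else 1) * p ^ (j + c - 1 - i) =
      p ^ c * qNumber p j + x * qNumber p c := by
  rw [Finset.sum_range_add, ← sum_range_pow_sub p j, ← sum_range_pow_sub p c, Finset.mul_sum,
    Finset.mul_sum]
  congr 1 <;> refine Finset.sum_congr rfl fun i hi => ?_
  · have := Finset.mem_range.1 hi
    rw [if_neg (by omega), one_mul, ← pow_add]
    congr 1
    omega
  · rw [if_pos (Nat.le_add_right j i)]
    congr 2
    omega

/-- The sum of `χ (sign σ) * q ^ maj σ` over the permutations with a given last entry. -/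
theorem sum_appendLast (n : ℕ) (j : Fin (n + 1)) :
    ∑ τ : Equiv.Perm (Fin n), χ (appendLast j τ).sign * q ^ maj (appendLast j τ) =
      (χ (-1) ^ n * q) ^ (n - j) * permSum χ q n := by
  induction n with
  | zero => simp [permSum, maj_of_perm_zero, maj_eq_sum, sign_appendLast]
  | succ n ih =>
    set ε := χ (-1) with hε
    have hεε : ε * ε = 1 := by rw [hε, ← map_mul]; simp
    have hε2 : ∀ m, ε ^ (2 * m) = 1 := fun m => by rw [pow_mul, sq, hεε, one_pow]
    set p := ε ^ n * q with hp
    have hsum : permSum χ q (n + 1) = qNumber p (n + 1) * permSum χ q n := by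
      rw [permSum, sum_perm_succ, Finset.sum_congr rfl fun i _ => ih i, ← Finset.sum_mul,
        Fin.sum_univ_eq_sum_range (fun i => p ^ (n - i)), ← sum_range_pow_sub]
      rfl
    have hstep : ∀ i : Fin (n + 1), ∑ τ : Equiv.Perm (Fin n),
        χ (appendLast j (appendLast i τ)).sign * q ^ maj (appendLast j (appendLast i τ)) =
        ε ^ ((j : ℕ) + (n + 1)) *
          ((if (j : ℕ) ≤ i then q ^ (n + 1) else 1) * p ^ (n - i)) * permSum χ q n := by
      intro i
      rw [mul_assoc, mul_assoc, ← ih i, Finset.mul_sum, Finset.mul_sum]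
      refine Finset.sum_congr rfl fun τ _ => ?_
      rw [sign_appendLast j, maj_appendLast_appendLast, map_mul, map_pow, ← hε, pow_add q]
      split_ifs <;> ring
    obtain ⟨c, hc⟩ := Nat.exists_eq_add_of_le (Nat.lt_succ_iff.1 j.2)
    have hpε : ε ^ (n + 1) * q = ε * p := by rw [hp]; ring
    have hsgn : ε ^ ((j : ℕ) + (n + 1)) = ε ^ c := by
      rw [show (j : ℕ) + (n + 1) = 2 * j + c by omega, pow_add, hε2, one_mul]
    -- Since `n * (n + 1)` is even, the weight of the new descent is a power of `p` too. The two
    -- ranges of `i` then combine to `p ^ c * qNumber p (n + 1)`.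
    have hpn : p ^ (n + 1) = q ^ (n + 1) := by
      obtain ⟨m, hm⟩ := Nat.even_mul_succ_self n
      rw [hp, mul_pow, ← pow_mul, hm, ← two_mul, hε2, one_mul]
    rw [sum_perm_succ, Finset.sum_congr rfl fun i _ => hstep i, ← Finset.sum_mul,
      ← Finset.mul_sum, hsum, hpε, hsgn, ← mul_assoc,
      Fin.sum_univ_eq_sum_range
        (fun i => (if (j : ℕ) ≤ i then q ^ (n + 1) else 1) * p ^ (n - i))]
    have hs := sum_range_ite_mul_pow p (q ^ (n + 1)) j c
    rw [← hc, Nat.add_sub_cancel] at hs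
    have hN : qNumber p (n + 1) = qNumber p j + p ^ (j : ℕ) * qNumber p c := by
      rw [← qNumber_add]
      exact congrArg _ hc
    have hpc : p ^ (n + 1) = p ^ (j : ℕ) * p ^ c := by
      rw [← pow_add]
      exact congrArg _ hc
    rw [hs, ← hpn, show n + 1 - (j : ℕ) = c by omega, hN, hpc]
    ring

theorem permSum_succ (n : ℕ) :
    permSum χ q (n + 1) = qNumber (χ (-1) ^ n * q) (n + 1) * permSum χ q n := by
  rw [permSum, sum_perm_succ, Finset.sum_congr rfl fun i _ => sum_appendLast χ q n i,
    ← Finset.sum_mul, Fin.sum_univ_eq_sum_range (fun i => (χ (-1) ^ n * q) ^ (n - i)),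
    ← sum_range_pow_sub]
  rfl

theorem permSum_one (n : ℕ) : permSum (1 : ℤˣ →* R) q n = qFactorial q n := by
  induction n with
  | zero => simp [permSum_zero]
  | succ n ih => rw [permSum_succ, qFactorial_succ, ih]; simp [mul_comm]

/-- The sign of a permutation, as an element of an arbitrary ring. -/
def signHom (R : Type*) [CommRing R] : ℤˣ →* R :=
  (Int.castRingHom R).toMonoidHom.comp (Units.coeHom ℤ)

/-- Both sides equal `1 - q ^ (2 * m)` by the geometric sum. -/
theorem qNumber_neg_two_mul (m : ℕ) :
    (1 + q) * qNumber (-q) (2 * m) = (1 - q) * qNumber q (2 * m) := by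
  have h1 := mul_neg_geom_sum q (2 * m)
  have h2 := mul_neg_geom_sum (-q) (2 * m)
  rw [sub_neg_eq_add, Even.neg_pow (even_two_mul m)] at h2
  exact h2.trans h1.symm

/-- Only the factors of even index have base `-q`; each of these `n / 2` factors contributes `(1 -
q) / (1 + q)` relative to `[n]_q!`. -/
theorem permSum_signHom {K : Type*} [Field K] {q : K} (hq : 1 + q ≠ 0) (n : ℕ) :
    permSum (signHom K) q n = ((1 - q) / (1 + q)) ^ (n / 2) * qFactorial q n := by
  induction n with
  | zero => simp [permSum_zero]
  | succ n ih =>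
    have hs : signHom K (-1) = -1 := by simp [signHom]
    rw [permSum_succ, qFactorial_succ, ih, hs]
    rcases Nat.even_or_odd' n with ⟨m, rfl | rfl⟩
    · rw [show (2 * m + 1) / 2 = m by omega, show 2 * m / 2 = m by omega, pow_mul]
      simp
      ring
    · have h := qNumber_neg_two_mul q (m + 1)
      have h' : qNumber (-q) (2 * (m + 1)) = (1 - q) / (1 + q) * qNumber q (2 * (m + 1)) := by
        rw [div_mul_eq_mul_div, eq_div_iff hq, mul_comm, h]
      rw [show (2 * m + 1 + 1) / 2 = m + 1 by omega, show (2 * m + 1) / 2 = m by omega,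
        show 2 * m + 1 + 1 = 2 * (m + 1) by ring,
        show (-1 : K) ^ (2 * m + 1) * q = -q by rw [pow_succ, pow_mul]; simp, h']
      ring

end LastLetter

/-! ### Reduction of a permutation to its derangement part. -/

section DerangementPart

/-- `v` orders the subcedants of `σ` as `σ` does and makes them negative, does the same for the
excedants with positive values, and vanishes at the fixed points. -/
structure IsLabelling {n : ℕ} (σ : Equiv.Perm (Fin n)) (v : ℕ → ℤ) : Prop where
  neg_iff : ∀ i : Fin n, v i < 0 ↔ σ i < i
  pos_iff : ∀ i : Fin n, 0 < v i ↔ i < σ i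
  lt_iff_of_neg : ∀ i j : Fin n, σ i < i → σ j < j → (v i < v j ↔ σ i < σ j)
  lt_iff_of_pos : ∀ i j : Fin n, i < σ i → j < σ j → (v i < v j ↔ σ i < σ j)

/-- For neighbouring positions of different kinds, the kinds alone determine whether there is a
descent, as the signs of the labels do; for equal kinds the labels are ordered like the entries, and
two fixed points give none. -/
theorem IsLabelling.maj_eq {n : ℕ} {σ : Equiv.Perm (Fin n)} {v : ℕ → ℤ} (h : IsLabelling σ v) :
    maj σ = wordMaj v (n - 1) := by
  cases n with
  | zero => simp [maj_of_perm_zero, wordMaj]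
  | succ n =>
    rw [maj_eq_sum, Nat.add_sub_cancel, wordMaj,
      ← Fin.sum_univ_eq_sum_range (fun i => if v (i + 1) < v i then i + 1 else 0)]
    refine Finset.sum_congr rfl fun i _ => if_congr ?_ rfl rfl
    have a1 := h.neg_iff i.castSucc
    have a2 := h.neg_iff i.succ
    have b1 := h.pos_iff i.castSucc
    have b2 := h.pos_iff i.succ
    have c := h.lt_iff_of_neg i.succ i.castSucc
    have d := h.lt_iff_of_pos i.succ i.castSucc
    -- Distinctness makes the comparison strict when an excedant precedes a fixed point or a
    -- subcedant follows one.
    have e : (σ i.succ : ℕ) ≠ σ i.castSucc := fun h => by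
      have := σ.injective (Fin.ext h)
      simp [Fin.ext_iff] at this
    simp only [Fin.lt_def, Fin.val_castSucc, Fin.val_succ] at a1 a2 b1 b2 c d ⊢
    omega

/-- A labelling of a permutation by its values, shifted. -/
def label {k : ℕ} (δ : Equiv.Perm (Fin k)) (r : ℕ) : ℤ :=
  if h : r < k then
    if δ ⟨r, h⟩ < ⟨r, h⟩ then (δ ⟨r, h⟩ : ℤ) - k
    else if ⟨r, h⟩ < δ ⟨r, h⟩ then (δ ⟨r, h⟩ : ℤ) + 1 else 0
  else 0

theorem label_val {k : ℕ} (δ : Equiv.Perm (Fin k)) (r : Fin k) :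
    label δ r = if δ r < r then (δ r : ℤ) - k else if r < δ r then (δ r : ℤ) + 1 else 0 := by
  simp [label]

theorem isLabelling_label {k : ℕ} (δ : Equiv.Perm (Fin k)) : IsLabelling δ (label δ) := by
  constructor
  · intro i
    rw [label_val]
    have := (δ i).2
    split_ifs <;> omega
  · intro i
    rw [label_val]
    have := (δ i).2
    split_ifs <;> omega
  · intro i j hi hj
    rw [label_val, label_val, if_pos hi, if_pos hj]
    omega
  · intro i j hi hj
    rw [label_val, label_val, if_neg hi.not_gt, if_neg hj.not_gt, if_pos hi, if_pos hj]
    omega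

/-- The permutation of `Fin n` that acts on `S` as `δ` does on `Fin k`, with the elements of `S`
in increasing order, and fixes all other points. -/
def extend {n k : ℕ} {S : Finset (Fin n)} (hS : S.card = k) (δ : Equiv.Perm (Fin k)) :
    Equiv.Perm (Fin n) :=
  Equiv.Perm.ofSubtype ((S.orderIsoOfFin hS).toEquiv.permCongr δ)

theorem sign_extend {n k : ℕ} {S : Finset (Fin n)} (hS : S.card = k) (δ : Equiv.Perm (Fin k)) :
    (extend hS δ).sign = δ.sign := by
  rw [extend, Equiv.Perm.sign_ofSubtype, Equiv.Perm.sign_permCongr]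

theorem extend_orderEmbOfFin {n k : ℕ} {S : Finset (Fin n)} (hS : S.card = k)
    (δ : Equiv.Perm (Fin k)) (r : Fin k) :
    extend hS δ (S.orderEmbOfFin hS r) = S.orderEmbOfFin hS (δ r) := by
  have h : S.orderEmbOfFin hS r = (S.orderIsoOfFin hS r : Fin n) := rfl
  rw [extend, h, Equiv.Perm.ofSubtype_apply_coe]
  simp [Equiv.permCongr_apply]

theorem extend_of_notMem {n k : ℕ} {S : Finset (Fin n)} (hS : S.card = k)
    (δ : Equiv.Perm (Fin k)) {i : Fin n} (hi : i ∉ S) : extend hS δ i = i :=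
  Equiv.Perm.ofSubtype_apply_of_not_mem _ hi

theorem padZeros_orderEmbOfFin {n k : ℕ} {S : Finset (Fin n)} (hS : S.card = k) (w : ℕ → ℤ)
    (r : Fin k) : padZeros (S.map Fin.valEmbedding) w (S.orderEmbOfFin hS r) = w r := by
  have hmem : (S.orderEmbOfFin hS r : ℕ) ∈ S.map Fin.valEmbedding :=
    Finset.mem_map_of_mem Fin.valEmbedding (Finset.orderEmbOfFin_mem S hS r)
  have hcard : (S.map Fin.valEmbedding).filter (· < (S.orderEmbOfFin hS r : ℕ)) =
      (Finset.Iio r).map ((S.orderEmbOfFin hS).toEmbedding.trans Fin.valEmbedding) := by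
    ext x
    simp only [Finset.mem_filter, Finset.mem_map, Finset.mem_Iio]
    constructor
    · rintro ⟨⟨y, hy, rfl⟩, hlt⟩
      have : y ∈ Set.range (S.orderEmbOfFin hS) := by
        rw [Finset.range_orderEmbOfFin]
        exact hy
      obtain ⟨s, rfl⟩ := this
      exact ⟨s, (S.orderEmbOfFin hS).lt_iff_lt.1 (Fin.lt_def.2 hlt), rfl⟩
    · rintro ⟨s, hs, rfl⟩
      exact ⟨⟨_, Finset.orderEmbOfFin_mem S hS s, rfl⟩, (S.orderEmbOfFin hS).lt_iff_lt.2 hs⟩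
  rw [padZeros, if_pos hmem, hcard, Finset.card_map, Fin.card_Iio]

theorem padZeros_of_notMem {n : ℕ} {S : Finset (Fin n)} (w : ℕ → ℤ) {i : Fin n} (hi : i ∉ S) :
    padZeros (S.map Fin.valEmbedding) w i = 0 := by
  refine if_neg fun h => hi ?_
  obtain ⟨j, hj, hji⟩ := Finset.mem_map.1 h
  rwa [← Fin.ext (show (j : ℕ) = i from hji)]

theorem eq_orderEmbOfFin_or_notMem {n k : ℕ} {S : Finset (Fin n)} (hS : S.card = k) (i : Fin n) :
    (∃ r, S.orderEmbOfFin hS r = i) ∨ i ∉ S := by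
  by_cases hi : i ∈ S
  · left
    have : i ∈ Set.range (S.orderEmbOfFin hS) := by
      rw [Finset.range_orderEmbOfFin]
      exact hi
    exact this
  · exact Or.inr hi

/-- The increasing enumeration of `S` preserves all comparisons, and points outside `S` are fixed,
matching the zeros. -/
theorem IsLabelling.extend {n k : ℕ} {S : Finset (Fin n)} (hS : S.card = k)
    {δ : Equiv.Perm (Fin k)} {w : ℕ → ℤ} (h : IsLabelling δ w) :
    IsLabelling (extend hS δ) (padZeros (S.map Fin.valEmbedding) w) := by
  have hlt := fun r s => (S.orderEmbOfFin hS).lt_iff_lt (a := r) (b := s)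
  constructor
  · intro i
    rcases eq_orderEmbOfFin_or_notMem hS i with ⟨r, rfl⟩ | hi
    · rw [padZeros_orderEmbOfFin, extend_orderEmbOfFin, hlt]
      exact h.neg_iff r
    · simp [padZeros_of_notMem w hi, extend_of_notMem hS δ hi]
  · intro i
    rcases eq_orderEmbOfFin_or_notMem hS i with ⟨r, rfl⟩ | hi
    · rw [padZeros_orderEmbOfFin, extend_orderEmbOfFin, hlt]
      exact h.pos_iff r
    · simp [padZeros_of_notMem w hi, extend_of_notMem hS δ hi]
  · intro i j hi hj
    rcases eq_orderEmbOfFin_or_notMem hS i with ⟨r, rfl⟩ | hi'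
    · rcases eq_orderEmbOfFin_or_notMem hS j with ⟨s, rfl⟩ | hj'
      · rw [extend_orderEmbOfFin, hlt] at hi hj
        rw [padZeros_orderEmbOfFin, padZeros_orderEmbOfFin, extend_orderEmbOfFin,
          extend_orderEmbOfFin, hlt]
        exact h.lt_iff_of_neg r s hi hj
      · simp [extend_of_notMem hS δ hj'] at hj
    · simp [extend_of_notMem hS δ hi'] at hi
  · intro i j hi hj
    rcases eq_orderEmbOfFin_or_notMem hS i with ⟨r, rfl⟩ | hi'
    · rcases eq_orderEmbOfFin_or_notMem hS j with ⟨s, rfl⟩ | hj'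
      · rw [extend_orderEmbOfFin, hlt] at hi hj
        rw [padZeros_orderEmbOfFin, padZeros_orderEmbOfFin, extend_orderEmbOfFin,
          extend_orderEmbOfFin, hlt]
        exact h.lt_iff_of_pos r s hi hj
      · simp [extend_of_notMem hS δ hj'] at hj
    · simp [extend_of_notMem hS δ hi'] at hi

open Classical in
/-- The sum of `χ (sign σ) * q ^ maj σ` over the derangements `σ` of `n` letters. -/
noncomputable def derangementSum {R : Type*} [CommRing R] (χ : ℤˣ →* R) (q : R) (n : ℕ) : R :=
  ∑ σ : Equiv.Perm (Fin n) with σ ∈ derangements (Fin n), χ σ.sign * q ^ maj σ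

-- A permutation restricts to its support without fixed points; increasing relabelling turns the
-- restriction into a derangement of `Fin k`.
open Classical in
theorem sum_support_eq {M : Type*} [AddCommMonoid M] {n k : ℕ} {S : Finset (Fin n)}
    (hS : S.card = k) (f : Equiv.Perm (Fin n) → M) :
    ∑ σ : Equiv.Perm (Fin n) with σ.support = S, f σ =
      ∑ δ : Equiv.Perm (Fin k) with δ ∈ derangements (Fin k), f (extend hS δ) := by
  symm
  refine Finset.sum_bij (fun δ _ => extend hS δ) ?_ ?_ ?_ fun _ _ => rfl
  · intro δ hδ
    rw [Finset.mem_filter] at hδ ⊢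
    refine ⟨Finset.mem_univ _, Finset.ext fun i => ?_⟩
    rw [Equiv.Perm.mem_support]
    rcases eq_orderEmbOfFin_or_notMem hS i with ⟨r, rfl⟩ | hi
    · rw [extend_orderEmbOfFin, (S.orderEmbOfFin hS).injective.ne_iff]
      exact iff_of_true (hδ.2 r) (Finset.orderEmbOfFin_mem S hS r)
    · simp [extend_of_notMem hS δ hi, hi]
  · intro δ _ δ' _ h
    exact (S.orderIsoOfFin hS).toEquiv.permCongr.injective
      (Equiv.Perm.ofSubtype_injective h)
  · intro σ hσ
    obtain rfl := (Finset.mem_filter.1 hσ).2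
    have hmem : ∀ i, σ i ∈ σ.support ↔ i ∈ σ.support := fun i => Equiv.Perm.apply_mem_support
    set e := (σ.support.orderIsoOfFin hS).toEquiv
    have hext : extend hS (e.symm.permCongr (σ.subtypePerm hmem)) = σ := by
      have : e.permCongr (e.symm.permCongr (σ.subtypePerm hmem)) = σ.subtypePerm hmem := by
        ext; simp [Equiv.permCongr_apply]
      rw [extend, this]
      exact Equiv.Perm.ofSubtype_subtypePerm hmem fun i hi => Equiv.Perm.mem_support.2 hi
    refine ⟨e.symm.permCongr (σ.subtypePerm hmem), ?_, hext⟩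
    refine Finset.mem_filter.2 ⟨Finset.mem_univ _, fun r hr => ?_⟩
    have h1 := extend_orderEmbOfFin hS (e.symm.permCongr (σ.subtypePerm hmem)) r
    rw [hext, hr] at h1
    exact Equiv.Perm.mem_support.1 (Finset.orderEmbOfFin_mem σ.support hS r) h1

variable {K : Type*} [Field K] (χ : ℤˣ →* K) {q : K}

theorem label_ne_zero {k : ℕ} {δ : Equiv.Perm (Fin k)} (hδ : δ ∈ derangements (Fin k)) :
    ∀ r < k, label δ r ≠ 0 := by
  intro r hr h0
  have h1 := (isLabelling_label δ).neg_iff ⟨r, hr⟩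
  have h2 := (isLabelling_label δ).pos_iff ⟨r, hr⟩
  simp only [h0, lt_irrefl, false_iff, not_lt] at h1 h2
  exact hδ ⟨r, hr⟩ (le_antisymm h2 h1)

/-- Exchange the sums: for fixed `δ`, the sets `S` run through all insertions of zeros into the
label word of `δ`, while the sign stays that of `δ`. -/
theorem sum_card_support_eq (hq : ∀ m, qFactorial q m ≠ 0) (n k : ℕ) :
    ∑ S ∈ Finset.powersetCard k (Finset.univ : Finset (Fin n)),
        ∑ σ : Equiv.Perm (Fin n) with σ.support = S, χ σ.sign * q ^ maj σ =
      gaussBinom q n k * derangementSum χ q k := by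
  classical
  have h1 : ∀ S ∈ Finset.powersetCard k (Finset.univ : Finset (Fin n)),
      ∑ σ : Equiv.Perm (Fin n) with σ.support = S, χ σ.sign * q ^ maj σ =
        ∑ δ : Equiv.Perm (Fin k) with δ ∈ derangements (Fin k), χ δ.sign *
          q ^ wordMaj (padZeros (S.map Fin.valEmbedding) (label δ)) (n - 1) := by
    intro S hS
    have hS := (Finset.mem_powersetCard.1 hS).2
    rw [sum_support_eq hS]
    refine Finset.sum_congr rfl fun δ _ => ?_
    rw [sign_extend, ((isLabelling_label δ).extend hS).maj_eq]
  rw [Finset.sum_congr rfl h1, Finset.sum_comm, derangementSum, Finset.mul_sum]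
  refine Finset.sum_congr rfl fun δ hδ => ?_
  have hδ := (Finset.mem_filter.1 hδ).2
  have h2 := sum_pow_wordMaj_padZeros hq n k (label_ne_zero hδ)
  have hr : Finset.range n = (Finset.univ : Finset (Fin n)).map Fin.valEmbedding := by
    ext x
    simp
  rw [hr, Finset.powersetCard_map, Finset.sum_map] at h2
  rw [← Finset.mul_sum, (isLabelling_label δ).maj_eq]
  refine (congrArg (χ δ.sign * ·) h2).trans ?_
  ring

theorem permSum_eq_sum_gaussBinom (hq : ∀ m, qFactorial q m ≠ 0) (n : ℕ) :
    permSum χ q n = ∑ k ∈ Finset.range (n + 1), gaussBinom q n k * derangementSum χ q k := by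
  classical
  rw [permSum, ← Finset.sum_fiberwise Finset.univ Equiv.Perm.support, ← Finset.powerset_univ,
    Finset.sum_powerset, Finset.card_univ, Fintype.card_fin]
  exact Finset.sum_congr rfl fun k _ => sum_card_support_eq χ hq n k

end DerangementPart

/-! ### Passage to rational functions and the even derangements. -/

theorem map_qNumber {R S : Type*} [CommSemiring R] [CommSemiring S] (f : R →+* S) (q : R) (m : ℕ) :
    f (qNumber q m) = qNumber (f q) m := by
  simp [qNumber]

theorem qNumber_ratFunc_X_ne_zero (m : ℕ) : qNumber (RatFunc.X : RatFunc ℚ) (m + 1) ≠ 0 := by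
  rw [← RatFunc.algebraMap_X, ← map_qNumber]
  refine RatFunc.algebraMap_ne_zero fun h => ?_
  -- The constant term is `1`.
  have := congrArg (Polynomial.eval 0) h
  simp [qNumber, Polynomial.eval_finsetSum, Finset.sum_range_succ'] at this

theorem qFactorial_ratFunc_X_ne_zero (m : ℕ) : qFactorial (RatFunc.X : RatFunc ℚ) m ≠ 0 := by
  induction m with
  | zero => simp
  | succ m ih =>
    rw [qFactorial_succ]
    exact mul_ne_zero ih (qNumber_ratFunc_X_ne_zero m)

/-- Averaging the two characters of `ℤˣ` picks out the even permutations. -/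
theorem algebraMap_evenDerangementPoly (n : ℕ) :
    algebraMap (Polynomial ℚ) (RatFunc ℚ) (evenDerangementPoly n) =
      1 / 2 * derangementSum 1 RatFunc.X n +
        1 / 2 * derangementSum (signHom (RatFunc ℚ)) RatFunc.X n := by
  classical
  rw [evenDerangementPoly, evenDerangements, derangementSum, derangementSum, Finset.mul_sum,
    Finset.mul_sum, ← Finset.sum_add_distrib, ← Finset.filter_filter, Finset.sum_filter, map_sum]
  refine Finset.sum_congr (by congr) fun σ _ => ?_
  have hσ := even_length_iff σ
  rw [Equiv.Perm.mem_alternatingGroup] at hσ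
  rcases Int.units_eq_one_or σ.sign with h | h
  · rw [if_pos (hσ.2 h), h]
    simp
    ring
  · rw [if_neg fun hl => absurd (h.symm.trans (hσ.1 hl)) (by decide), h]
    simp [signHom]

end DerangementMaj

open DerangementMaj in
theorem mainTheorem10 (n : ℕ) (hn : 1 ≤ n) :
    algebraMap (Polynomial ℚ) (RatFunc ℚ) (DerangementMaj.evenDerangementPoly n) =
      DerangementMaj.qFactorial (RatFunc.X : RatFunc ℚ) n *
        ∑ k ∈ Finset.range (n + 1),
          (-1) ^ k / DerangementMaj.qFactorial (RatFunc.X : RatFunc ℚ) k *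
            RatFunc.X ^ Nat.choose k 2 *
            (1 / 2 + 1 / 2 * ((1 - RatFunc.X) / (1 + RatFunc.X)) ^ ((n - k) / 2)) := by
  have hq := qFactorial_ratFunc_X_ne_zero
  have h2 : (1 + RatFunc.X : RatFunc ℚ) ≠ 0 := by
    simpa [qNumber, Finset.sum_range_succ] using qNumber_ratFunc_X_ne_zero 1
  rw [algebraMap_evenDerangementPoly,
    gaussBinom_inversion hq (permSum_eq_sum_gaussBinom 1 hq),
    gaussBinom_inversion hq (permSum_eq_sum_gaussBinom (signHom (RatFunc ℚ)) hq),
    mul_left_comm, mul_left_comm (1 / 2 : RatFunc ℚ), ← mul_add, Finset.mul_sum, Finset.mul_sum,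
    ← Finset.sum_add_distrib]
  congr 1
  refine Finset.sum_congr rfl fun k _ => ?_
  -- Both sums over all permutations contain `[n - k]_q!`, which cancels and leaves `1` and the
  -- power of `(1 - q) / (1 + q)`.
  rw [permSum_one, permSum_signHom h2, div_self (hq _), mul_div_cancel_right₀ _ (hq _)]
  ring
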